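/- Let $\gamma_1\ge\gamma_2\ge\cdots>0$ be a non-increasing sequence of weights and suppose that $\sum_{j\ge1}\gamma_j^{\lambda^*}<\infty$ for some $0<\lambda^*<1$. Then there is a constant $C>0$, depending only on $\boldsymbol\gamma$ and $\lambda^*$, such that the following holds for every real $\alpha>1/2$. For a positive integer $s$ and $\boldsymbol h\in\mathbb Z^s$ put $r_{\alpha,\boldsymbol\gamma}(\boldsymbol h)=\prod_{1\le j\le s,\ h_j\neq0}\gamma_j|h_j|^{-2\alpha}$ (so $r_{\alpha,\boldsymbol\gamma}(\boldsymbol 0)=1$). The weighted Korobov space $H_{s,\alpha,\boldsymbol\gamma}$ consists of the real-valued $1$-periodic functions $f$ that are the sum of their absolutely convergent Fourier series with coefficients $\hat f(\boldsymbol h)=\int_{[0,1)^s}f(\boldsymbol x)e^{-2\pi i\boldsymbol h\cdot\boldsymbol x}\,\mathrm d\boldsymbol x$ and for which $\|f\|_{s,\alpha,\boldsymbol\gamma}^2=\sum_{\boldsymbol h\in\mathbb Z^s}|\hat f(\boldsymbol h)|^2/r_{\alpha,\boldsymbol\gamma}(\boldsymbol h)<\infty$. For a family $P=(\boldsymbol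 x_0,\dots,\boldsymbol x_{N-1})$ of $N$ points, the worst-case error of the equally weighted rule is $$e^{\mathrm{wor}}(H_{s,\alpha,\boldsymbol\gamma},P)=\sup_{\|f\|_{s,\alpha,\boldsymbol\gamma}\le1}\Big|\frac1N\sum_{n=0}^{N-1}f(\boldsymbol x_n)-\int_{[0,1)^s}f(\boldsymbol x)\,\mathrm d\boldsymbol x\Big| .$$ Let $N,s,d$ be positive integers with $d<s$. Let $\boldsymbol z\in\{1,\dots,N-1\}^d$ (so that $N\ge2$) be constructed component by component: $z_1=1$, and for $j=2,\dots,d$ the component $z_j$ minimizes $e^{\mathrm{wor}}(H_{j,\alpha,\boldsymbol\gamma},P_{N,j,(z_1,\dots,z_{j-1},z)})^2$ over $z\in\{1,\dots,N-1\}$, where $P_{N,j,\boldsymbol z}$ consists of the points $(\{nz_1/N\},\dots,\{nz_j/N\})$, $0\le n\le N-1$, and $\{\cdot\}$ is the fractional part. Let $x_{n,j}$ ($0\le n\le N-1$, $d<j\le s$) be independent random variables, uniformly distributed on $[0,1)$, and let $P_{N,s,d,\boldsymbol z}$ consist of the points $(\{nz_1/N\},\dots,\{nz_d/N\},x_{n,d+1},\dots,x_{n,s})$,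 $0\le n\le N-1$. Then, for every $\lambda\in(\max(\lambda^*,1/(2\alpha)),1]$, $$\mathbb E\big[e^{\mathrm{wor}}(H_{s,\alpha,\boldsymbol\gamma},P_{N,s,d,\boldsymbol z})^2\big]\le\Big[\frac1{\varphi(N)}\Big(-1+\exp\big(2C^\lambda\zeta(2\alpha\lambda)\zeta(\lambda/\lambda^*)\big)\Big)\Big]^{1/\lambda}+\frac{\exp\big(2C\zeta(2\alpha)\zeta(1/\lambda^*)\big)}{N\,d^{1/\lambda^*-1}}\Big[-1+\exp\Big(\frac{2C\zeta(2\alpha)}{1/\lambda^*-1}\Big)\Big],$$ where $\varphi$ is Euler's totient function and $\zeta$ the Riemann zeta function. The constant $C$, and hence the bound, does not depend on $s$. -/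

import Mathlib

open MeasureTheory ProbabilityTheory
open scoped ENNReal

noncomputable section

namespace Korobov

/-- The unit cube `[0,1)^s`. -/
def unitCube (s : ℕ) : Set (Fin s → ℝ) := Set.univ.pi fun _ => Set.Ico (0 : ℝ) 1

/-- The exponential `exp(2 π i h·x)`. -/
def expChar {s : ℕ} (h : Fin s → ℤ) (x : Fin s → ℝ) : ℂ :=
  Complex.exp (2 * Real.pi * Complex.I * ((∑ j, (h j : ℝ) * x j : ℝ) : ℂ))

/-- The exact integral `I(f)` over the unit cube. -/
def integral {s : ℕ} (f : (Fin s → ℝ) → ℝ) : ℝ := ∫ x in unitCube s, f x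

/-- The `h`-th Fourier coefficient of `f`, the integral of `f(x) exp(-2 π i h·x)` over the unit
cube. -/
def fourierCoef {s : ℕ} (f : (Fin s → ℝ) → ℝ) (h : Fin s → ℤ) : ℂ :=
  ∫ x in unitCube s, (f x : ℂ) * expChar (-h) x

/-- `r_{α,γ}(h)`, the product of `γ_j / |h_j|^(2α)` over the `j` with `h_j ≠ 0`. Coordinates and
weights are numbered from `0`, so `γ 0` is the weight of the first coordinate. -/
def r (α : ℝ) (γ : ℕ → ℝ) {s : ℕ} (h : Fin s → ℤ) : ℝ :=
  ∏ j : Fin s, if h j = 0 then 1 else γ j / |(h j : ℝ)| ^ (2 * α)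

/-- Membership in the weighted Korobov space `H_{s,α,γ}`: `f` is the (pointwise) sum of its
absolutely convergent Fourier series and has finite norm. A function on `[0,1)^s` is represented by
its `1`-periodic extension to `ℝ^s`; periodicity follows from the series representation, and for
complex series `HasSum` is absolute convergence. -/
structure MemKorobov (α : ℝ) (γ : ℕ → ℝ) (s : ℕ) (f : (Fin s → ℝ) → ℝ) : Prop where
  hasSum : ∀ x : Fin s → ℝ, HasSum (fun h : Fin s → ℤ => fourierCoef f h * expChar h x) (f x : ℂ)
  summable : Summable fun h : Fin s → ℤ => ‖fourierCoef f h‖ ^ 2 / r α γ h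

/-- The norm of the weighted Korobov space (note that `r α γ 0 = 1`). -/
def korobovNorm (α : ℝ) (γ : ℕ → ℝ) {s : ℕ} (f : (Fin s → ℝ) → ℝ) : ℝ :=
  Real.sqrt (∑' h : Fin s → ℤ, ‖fourierCoef f h‖ ^ 2 / r α γ h)

/-- The equally weighted quadrature rule with the `N` points `P 0, …, P (N-1)`. -/
def quadrature {N s : ℕ} (P : Fin N → Fin s → ℝ) (f : (Fin s → ℝ) → ℝ) : ℝ :=
  (1 / (N : ℝ)) * ∑ n, f (P n)

/-- The worst-case error of the equally weighted rule with points `P` in `H_{s,α,γ}`: the supremum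
of the absolute integration error over the unit ball, taken in `[0,∞]`. -/
def worstCaseError (α : ℝ) (γ : ℕ → ℝ) {N s : ℕ} (P : Fin N → Fin s → ℝ) : ℝ≥0∞ :=
  ⨆ (f : (Fin s → ℝ) → ℝ) (_ : MemKorobov α γ s f) (_ : korobovNorm α γ f ≤ 1),
    ENNReal.ofReal |quadrature P f - integral f|

/-- The rank-1 lattice point set with `N` points and generating vector `z`. -/
def latticePoints (N : ℕ) {d : ℕ} (z : Fin d → ℕ) : Fin N → Fin d → ℝ :=
  fun n j => Int.fract ((n : ℝ) * (z j : ℝ) / (N : ℝ))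

/-- `z` in `{1,…,N-1}^d` is a possible output of the component-by-component algorithm: its first
component is `1`, and each later component minimizes, with the previous components kept fixed, the
squared worst-case error of the lattice rule in the coordinates treated so far (ties may be broken
in any way). -/
structure IsCBC (α : ℝ) (γ : ℕ → ℝ) (N d : ℕ) (z : Fin d → ℕ) : Prop where
  mem : ∀ j, z j ∈ Finset.Icc 1 (N - 1)
  first : ∀ j : Fin d, (j : ℕ) = 0 → z j = 1
  step : ∀ (j : ℕ) (hj : j < d), 0 < j → ∀ w ∈ Finset.Icc 1 (N - 1),
    worstCaseError α γ (latticePoints N fun i : Fin (j + 1) => z (Fin.castLE hj i)) ^ 2 ≤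
      worstCaseError α γ (latticePoints N
        (Fin.snoc (α := fun _ => ℕ) (fun i : Fin j => z (Fin.castLE hj.le i)) w)) ^ 2

/-- The concatenated point set: the `n`-th point has the lattice point in its first `d` coordinates
and the given numbers `x n j` in the remaining `s - d` ones. -/
def concatPoints {N s d : ℕ} (z : Fin d → ℕ) (x : Fin N → {j : Fin s // d ≤ (j : ℕ)} → ℝ) :
    Fin N → Fin s → ℝ :=
  fun n j => if h : (j : ℕ) < d then latticePoints N z n ⟨j, h⟩ else x n ⟨j, not_lt.mp h⟩

/-- The Riemann zeta function at a real argument (only used for arguments greater than `1`). -/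
def realZeta (x : ℝ) : ℝ := (riemannZeta (x : ℂ)).re

end Korobov

end

namespace Korobov

/-! Cauchy–Schwarz in the weighted Fourier coefficients, together with its extremal function, turns
the squared worst-case error into the sum over h ≠ 0 of r(h) times the squared modulus of the mean
of exp(2πi h·x) over the points (`worstCaseError_sq`). The expectation can then be taken one
frequency at a time (`lintegral_sqError_concatPoints`). If h vanishes in the random coordinates, its
term is that of the lattice rule. Otherwise independence and uniformity kill every cross term
between different points, and the mean square is exactly 1/N.

For the lattice rule the character means are indicators of the dual lattice, and appending a
component adds an increment to the squared error E. Subadditivity of x^λ moves the power λ inside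
the increment, and the chosen component does no worse than the average over the φ(N) units modulo N.
Counting the units w with N ∣ a + k w bounds that average uniformly in a (`tsum_count_le`), and
induction gives φ(N) E^λ + 1 ≤ ∏ (1 + 2 γ_j^λ ζ(2αλ)) (`totient_mul_sqError_rpow_le`).

Monotonicity of the weights gives γ_j ≤ C j^(-1/λ*), with j counted from one and C = (∑
γ_j^λ*)^(1/λ*). Hence 1 + x ≤ e^x bounds the products by exponentials of zeta values, free of d and
s. The factor d^(-(1/λ* - 1)) comes from the tail of the weights and leaves the exponent by
convexity. -/

/-! ### Zeta values as sums over nonzero integers. -/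

theorem hasSum_realZeta {x : ℝ} (hx : 1 < x) :
    HasSum (fun n : ℕ => 1 / ((n : ℝ) + 1) ^ x) (realZeta x) := by
  have hs : Summable (fun n : ℕ => 1 / ((n : ℝ) + 1) ^ x) := by
    have := (summable_nat_add_iff 1).2 (Real.summable_one_div_nat_rpow.2 hx)
    simpa using this
  have h : riemannZeta (x : ℂ) = ((∑' n : ℕ, 1 / ((n : ℝ) + 1) ^ x : ℝ) : ℂ) := by
    rw [zeta_eq_tsum_one_div_nat_add_one_cpow (by simpa using hx), Complex.ofReal_tsum]
    refine tsum_congr fun n => ?_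
    rw [Complex.ofReal_div, Complex.ofReal_cpow (by positivity)]
    simp
  rw [realZeta, h, Complex.ofReal_re]
  exact hs.hasSum

theorem realZeta_nonneg {x : ℝ} (hx : 1 < x) : 0 ≤ realZeta x :=
  (hasSum_realZeta hx).nonneg fun n => by positivity

theorem tsum_int_div_rpow {p c : ℝ} (hp : 1 < p) (hc : 0 ≤ c) :
    ∑' k : ℤ, (if k = 0 then 0 else ENNReal.ofReal (c / |(k : ℝ)| ^ p)) =
      ENNReal.ofReal (2 * c * realZeta p) := by
  have hz := (hasSum_realZeta hp).mul_left c
  have hsum : ∑' n : ℕ, ENNReal.ofReal (c / ((n : ℝ) + 1) ^ p) =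
      ENNReal.ofReal (c * realZeta p) := by
    rw [← hz.tsum_eq, ENNReal.ofReal_tsum_of_nonneg (fun n => by positivity) hz.summable]
    exact tsum_congr fun n => by rw [mul_one_div]
  have habs (n : ℕ) : |(n : ℝ) + 1| = n + 1 := abs_of_nonneg (by positivity)
  have hne (n : ℕ) : (n : ℤ) + 1 ≠ 0 := by positivity
  rw [tsum_of_nat_of_neg_add_one ENNReal.summable ENNReal.summable,
    tsum_eq_zero_add' ENNReal.summable]
  have e1 : ∀ n : ℕ, (if (-((n : ℤ) + 1)) = 0 then 0 else
      ENNReal.ofReal (c / |((-((n : ℤ) + 1) : ℤ) : ℝ)| ^ p)) =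
      ENNReal.ofReal (c / ((n : ℝ) + 1) ^ p) := fun n => by
    rw [if_neg (neg_ne_zero.2 (hne n))]
    push_cast
    rw [abs_neg, habs]
  have e2 : ∀ n : ℕ, (if (((n + 1 : ℕ) : ℤ)) = 0 then 0 else
      ENNReal.ofReal (c / |(((n + 1 : ℕ) : ℤ) : ℝ)| ^ p)) =
      ENNReal.ofReal (c / ((n : ℝ) + 1) ^ p) := fun n => by
    rw [if_neg (by positivity)]
    push_cast
    rw [habs]
  simp_rw [e1, e2, hsum]
  have := mul_nonneg hc (realZeta_nonneg hp)
  rw [Nat.cast_zero, if_pos rfl, zero_add, ← ENNReal.ofReal_add this this]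
  congr 1; ring

/-! ### The weights r and their total mass. -/

theorem r_zero (α : ℝ) (γ : ℕ → ℝ) {s : ℕ} : r α γ (0 : Fin s → ℤ) = 1 := by
  simp [r]

theorem r_pos (α : ℝ) {γ : ℕ → ℝ} (hγ : ∀ j, 0 < γ j) {s : ℕ} (h : Fin s → ℤ) :
    0 < r α γ h := by
  refine Finset.prod_pos fun j _ => ?_
  split_ifs with hj
  · exact one_pos
  · have := hγ j
    positivity

theorem r_neg (α : ℝ) (γ : ℕ → ℝ) {s : ℕ} (h : Fin s → ℤ) : r α γ (-h) = r α γ h := by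
  simp [r]

theorem r_rpow (α : ℝ) {γ : ℕ → ℝ} (hγ : ∀ j, 0 < γ j) (lam : ℝ) {s : ℕ} (h : Fin s → ℤ) :
    r α γ h ^ lam = r (α * lam) (fun j => γ j ^ lam) h := by
  rw [r, r, ← Real.finsetProd_rpow]
  · refine Finset.prod_congr rfl fun j _ => ?_
    split_ifs with hj
    · simp
    · rw [Real.div_rpow (hγ j).le (by positivity), ← Real.rpow_mul (abs_nonneg _), mul_assoc]
  · intro j _
    have := hγ j
    split_ifs <;> positivity

theorem r_snoc (α : ℝ) (γ : ℕ → ℝ) {s : ℕ} (h : Fin s → ℤ) (k : ℤ) :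
    r α γ (Fin.snoc (α := fun _ => ℤ) h k) =
      r α γ h * if k = 0 then 1 else γ s / |(k : ℝ)| ^ (2 * α) := by
  simp [r, Fin.prod_univ_castSucc]

theorem r_append (α : ℝ) (γ : ℕ → ℝ) {d t : ℕ} (h : Fin d → ℤ) (k : Fin t → ℤ) :
    r α γ (Fin.append h k) = r α γ h * r α (fun j => γ (d + j)) k := by
  simp [r, Fin.prod_univ_add]

theorem tsum_snoc {s : ℕ} (F : (Fin (s + 1) → ℤ) → ℝ≥0∞) :
    ∑' h, F h = ∑' (h : Fin s → ℤ) (k : ℤ), F (Fin.snoc (α := fun _ => ℤ) h k) := by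
  rw [← (Fin.snocEquiv fun _ : Fin (s + 1) => ℤ).tsum_eq, ENNReal.tsum_prod', ENNReal.tsum_comm]
  rfl

theorem tsum_append {d t : ℕ} (F : (Fin (d + t) → ℤ) → ℝ≥0∞) :
    ∑' h, F h = ∑' (h : Fin d → ℤ) (k : Fin t → ℤ), F (Fin.append h k) := by
  rw [← (Fin.appendEquiv (α := ℤ) d t).tsum_eq, ENNReal.tsum_prod']
  rfl

theorem tsum_int_eq_zero_add (F : ℤ → ℝ≥0∞) :
    ∑' k, F k = F 0 + ∑' k, if k = 0 then 0 else F k := by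
  classical
  convert ENNReal.tsum_eq_add_tsum_ite (f := F) 0

/-- The sum of all `r_{α,γ}(h)` as a real number. -/
noncomputable def rSum (α : ℝ) (γ : ℕ → ℝ) (s : ℕ) : ℝ :=
  ∏ j ∈ Finset.range s, (1 + 2 * γ j * realZeta (2 * α))

theorem one_le_rSum {α : ℝ} (hα : 1 / 2 < α) {γ : ℕ → ℝ} (hγ : ∀ j, 0 < γ j) (s : ℕ) :
    1 ≤ rSum α γ s := by
  refine Finset.one_le_prod fun j _ => ?_
  have h1 := hγ j
  have h2 := realZeta_nonneg (x := 2 * α) (by linarith)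
  have : 0 ≤ 2 * γ j * realZeta (2 * α) := by positivity
  linarith

/-- The sum factors over coordinates: each contributes 1 from frequency zero and 2γζ(2α) from the
others. -/
theorem tsum_r {α : ℝ} (hα : 1 / 2 < α) {γ : ℕ → ℝ} (hγ : ∀ j, 0 < γ j) (s : ℕ) :
    ∑' h : Fin s → ℤ, ENNReal.ofReal (r α γ h) = ENNReal.ofReal (rSum α γ s) := by
  induction s with
  | zero => simp [r, rSum]
  | succ s ih =>
    have h2 := realZeta_nonneg (x := 2 * α) (by linarith)
    have hp : 1 < 2 * α := by linarith
    have hk : ∀ h : Fin s → ℤ, ∑' k : ℤ, ENNReal.ofReal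
        (r α γ (Fin.snoc (α := fun _ => ℤ) h k)) = ENNReal.ofReal (r α γ h) *
          ENNReal.ofReal (1 + 2 * γ s * realZeta (2 * α)) := fun h => by
      have : ∀ k : ℤ, (if k = 0 then 0 else ENNReal.ofReal
          (if k = 0 then 1 else γ s / |(k : ℝ)| ^ (2 * α))) =
          (if k = 0 then 0 else ENNReal.ofReal (γ s / |(k : ℝ)| ^ (2 * α))) := fun k => by
        split_ifs <;> rfl
      have h3 := (hγ s).le
      simp_rw [r_snoc, ENNReal.ofReal_mul (r_pos α hγ h).le, ENNReal.tsum_mul_left]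
      rw [tsum_int_eq_zero_add]
      simp_rw [this]
      rw [tsum_int_div_rpow hp (hγ s).le, if_pos trivial, ← ENNReal.ofReal_add zero_le_one
        (by positivity)]
    rw [tsum_snoc]
    simp_rw [hk]
    rw [ENNReal.tsum_mul_right, ih, ← ENNReal.ofReal_mul (zero_le_one.trans (one_le_rSum hα hγ s)),
      rSum, rSum, Finset.prod_range_succ]

theorem summable_r {α : ℝ} (hα : 1 / 2 < α) {γ : ℕ → ℝ} (hγ : ∀ j, 0 < γ j) (s : ℕ) :
    Summable fun h : Fin s → ℤ => r α γ h := by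
  have h := ENNReal.summable_toReal ((tsum_r hα hγ s).trans_ne ENNReal.ofReal_ne_top)
  simpa only [ENNReal.toReal_ofReal (r_pos α hγ _).le] using h

/-- Substituting k = g m produces the factor g^(-p), which later beats the multiplicity g in
`tsum_count_le`. -/
theorem tsum_int_dvd_div_rpow {p c : ℝ} (hp : 1 < p) (hc : 0 ≤ c) {g : ℕ} (hg : 0 < g) :
    ∑' k : ℤ, (if k = 0 then 0 else if (g : ℤ) ∣ k then ENNReal.ofReal (c / |(k : ℝ)| ^ p) else 0) =
      ENNReal.ofReal (2 * c * realZeta p / (g : ℝ) ^ p) := by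
  have hg' : (g : ℤ) ≠ 0 := by positivity
  have hinj : Function.Injective fun m : ℤ => (g : ℤ) * m := mul_right_injective₀ hg'
  rw [← hinj.tsum_eq]
  · rw [show 2 * c * realZeta p / (g : ℝ) ^ p = 2 * (c / (g : ℝ) ^ p) * realZeta p by ring,
      ← tsum_int_div_rpow hp (by positivity)]
    refine tsum_congr fun m => ?_
    by_cases hm : m = 0
    · simp [hm]
    · rw [if_neg (mul_ne_zero hg' hm), if_pos (dvd_mul_right _ _), if_neg hm]
      congr 1
      push_cast
      rw [abs_mul, Real.mul_rpow (abs_nonneg _) (abs_nonneg _), Nat.abs_cast, div_div]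
  · intro k hk
    by_contra hcon
    refine hk ?_
    have : ¬ (g : ℤ) ∣ k := fun ⟨m, hm⟩ => hcon ⟨m, hm.symm⟩
    simp [this]

/-! ### Characters, orthogonality and Fourier coefficients. -/

theorem expChar_eq_prod {s : ℕ} (h : Fin s → ℤ) (x : Fin s → ℝ) :
    expChar h x = ∏ j, Complex.exp (2 * Real.pi * Complex.I * ((h j * x j : ℝ) : ℂ)) := by
  rw [expChar, ← Complex.exp_sum, Complex.ofReal_sum, Finset.mul_sum]

theorem expChar_eq_exp_mul_I {s : ℕ} (h : Fin s → ℤ) (x : Fin s → ℝ) :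
    expChar h x = Complex.exp (((2 * Real.pi * ∑ j, (h j : ℝ) * x j : ℝ) : ℂ) * Complex.I) := by
  rw [expChar]
  congr 1
  push_cast
  ring

theorem norm_expChar {s : ℕ} (h : Fin s → ℤ) (x : Fin s → ℝ) : ‖expChar h x‖ = 1 := by
  rw [expChar_eq_exp_mul_I, Complex.norm_exp_ofReal_mul_I]

theorem expChar_zero {s : ℕ} (x : Fin s → ℝ) : expChar 0 x = 1 := by
  simp [expChar]

theorem expChar_add {s : ℕ} (h k : Fin s → ℤ) (x : Fin s → ℝ) :
    expChar (h + k) x = expChar h x * expChar k x := by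
  rw [expChar, expChar, expChar, ← Complex.exp_add, ← mul_add, ← Complex.ofReal_add,
    ← Finset.sum_add_distrib]
  simp [add_mul]

theorem expChar_neg {s : ℕ} (h : Fin s → ℤ) (x : Fin s → ℝ) :
    expChar (-h) x = starRingEnd ℂ (expChar h x) := by
  rw [expChar_eq_exp_mul_I, expChar_eq_exp_mul_I, ← Complex.exp_conj, map_mul, Complex.conj_ofReal,
    Complex.conj_I]
  simp

theorem continuous_expChar {s : ℕ} (h : Fin s → ℤ) : Continuous (expChar h) := by
  unfold expChar
  fun_prop

theorem integral_Ico_exp (k : ℤ) :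
    ∫ x in Set.Ico (0 : ℝ) 1, Complex.exp (2 * Real.pi * Complex.I * ((k * x : ℝ) : ℂ)) =
      if k = 0 then 1 else 0 := by
  split_ifs with hk
  · simp [hk]
  · rw [integral_Ico_eq_integral_Ioc, ← intervalIntegral.integral_of_le zero_le_one]
    have hc : (2 * Real.pi * Complex.I * k : ℂ) ≠ 0 :=
      mul_ne_zero Complex.two_pi_I_ne_zero (Int.cast_ne_zero.2 hk)
    have h1 : Complex.exp (2 * Real.pi * Complex.I * k) = 1 := by
      rw [mul_comm]; exact Complex.exp_int_mul_two_pi_mul_I k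
    have := integral_exp_mul_complex (a := 0) (b := 1) hc
    simp only [Complex.ofReal_one, mul_one, h1, Complex.ofReal_zero, mul_zero, Complex.exp_zero,
      sub_self, zero_div] at this
    rw [← this]
    refine intervalIntegral.integral_congr fun x _ => ?_
    congr 1
    push_cast
    ring

theorem volume_restrict_unitCube (s : ℕ) :
    (volume : Measure (Fin s → ℝ)).restrict (unitCube s) =
      Measure.pi fun _ : Fin s => (volume : Measure ℝ).restrict (Set.Ico 0 1) :=
  Measure.restrict_pi_pi (fun _ => (volume : Measure ℝ)) _

instance isProbabilityMeasure_restrict_Ico :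
    IsProbabilityMeasure ((volume : Measure ℝ).restrict (Set.Ico 0 1)) :=
  ⟨by simp⟩

instance isProbabilityMeasure_restrict_unitCube (s : ℕ) :
    IsProbabilityMeasure ((volume : Measure (Fin s → ℝ)).restrict (unitCube s)) := by
  rw [volume_restrict_unitCube]
  infer_instance

theorem integral_expChar {s : ℕ} (h : Fin s → ℤ) :
    ∫ x in unitCube s, expChar h x = if h = 0 then 1 else 0 := by
  simp_rw [volume_restrict_unitCube, expChar_eq_prod]
  rw [integral_fintype_prod_eq_prod (f := fun (j : Fin s) (y : ℝ) =>
    Complex.exp (2 * Real.pi * Complex.I * ((h j * y : ℝ) : ℂ)))]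
  simp_rw [integral_Ico_exp]
  split_ifs with hh
  · simp [hh]
  · obtain ⟨j, hj⟩ := Function.ne_iff.1 hh
    exact Finset.prod_eq_zero (Finset.mem_univ j) (if_neg hj)

/-- Absolute summability permits termwise integration, and orthogonality isolates one coefficient.
This identifies the coefficients of the extremal function, which is defined by its series. -/
theorem fourierCoef_eq_of_hasSum {s : ℕ} {c : (Fin s → ℤ) → ℂ} (hc : Summable fun h => ‖c h‖)
    {f : (Fin s → ℝ) → ℝ} (hf : ∀ x, HasSum (fun h => c h * expChar h x) (f x : ℂ))
    (h : Fin s → ℤ) : fourierCoef f h = c h := by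
  have hint (k : Fin s → ℤ) : Integrable (fun x => c k * expChar (k - h) x)
      (volume.restrict (unitCube s)) := by
    refine Integrable.of_bound ((continuous_const.mul (continuous_expChar _)).aestronglyMeasurable)
      ‖c k‖ (ae_of_all _ fun x => ?_)
    rw [norm_mul, norm_expChar, mul_one]
  have hs := hasSum_integral_of_summable_integral_norm hint (by
    simpa only [norm_mul, norm_expChar, mul_one, integral_const, probReal_univ, one_smul] using hc)
  simp_rw [integral_const_mul, integral_expChar, sub_eq_zero, mul_ite, mul_one, mul_zero] at hs
  have hite : ∀ k, (if k = h then c k else 0) = if k = h then c h else 0 := fun k => by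
    split_ifs with hk
    · rw [hk]
    · rfl
  simp_rw [hite] at hs
  rw [(hasSum_ite_eq h (c h)).unique hs, fourierCoef]
  refine integral_congr_ae (ae_of_all _ fun x => ?_)
  simp only
  rw [← (hf x).tsum_eq, ← tsum_mul_right]
  exact tsum_congr fun k => by rw [mul_assoc, ← expChar_add, sub_eq_add_neg]

/-! ### The Fourier formula for the worst-case error. -/

/-- The mean of `exp(2 π i h·x)` over the points of `P`, with the constant frequency removed. -/
noncomputable def errCoef {N s : ℕ} (P : Fin N → Fin s → ℝ) (h : Fin s → ℤ) : ℂ :=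
  if h = 0 then 0 else (1 / (N : ℂ)) * ∑ n, expChar h (P n)

/-- The Fourier series expression of the squared worst-case error. -/
noncomputable def sqError (α : ℝ) (γ : ℕ → ℝ) {N s : ℕ} (P : Fin N → Fin s → ℝ) : ℝ≥0∞ :=
  ∑' h, ENNReal.ofReal (r α γ h * ‖errCoef P h‖ ^ 2)

theorem norm_errCoef_le {N s : ℕ} (P : Fin N → Fin s → ℝ) (h : Fin s → ℤ) :
    ‖errCoef P h‖ ≤ 1 := by
  rw [errCoef]
  split_ifs with hh
  · simp
  · rw [norm_mul, norm_div, norm_one, Complex.norm_natCast]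
    have : ‖∑ n, expChar h (P n)‖ ≤ N := by
      refine (norm_sum_le _ _).trans ?_
      simp [norm_expChar]
    rcases Nat.eq_zero_or_pos N with rfl | hN
    · simp
    · rw [one_div, inv_mul_le_iff₀ (by positivity), mul_one]
      exact this

theorem errCoef_neg {N s : ℕ} (P : Fin N → Fin s → ℝ) (h : Fin s → ℤ) :
    errCoef P (-h) = starRingEnd ℂ (errCoef P h) := by
  rw [errCoef, errCoef]
  by_cases hh : h = 0
  · simp [hh]
  · simp [hh, expChar_neg]

theorem summable_r_mul_sq {α : ℝ} (hα : 1 / 2 < α) {γ : ℕ → ℝ} (hγ : ∀ j, 0 < γ j) {N s : ℕ}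
    (P : Fin N → Fin s → ℝ) : Summable fun h => r α γ h * ‖errCoef P h‖ ^ 2 := by
  refine (summable_r hα hγ s).of_nonneg_of_le (fun h => ?_) fun h => ?_
  · have := r_pos α hγ h
    positivity
  · exact mul_le_of_le_one_right (r_pos α hγ h).le
      (pow_le_one₀ (norm_nonneg _) (norm_errCoef_le P h))

theorem sqError_eq {α : ℝ} (hα : 1 / 2 < α) {γ : ℕ → ℝ} (hγ : ∀ j, 0 < γ j) {N s : ℕ}
    (P : Fin N → Fin s → ℝ) :
    sqError α γ P = ENNReal.ofReal (∑' h, r α γ h * ‖errCoef P h‖ ^ 2) := by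
  rw [sqError, ENNReal.ofReal_tsum_of_nonneg _ (summable_r_mul_sq hα hγ P)]
  intro h
  have := r_pos α hγ h
  positivity

theorem fourierCoef_zero {s : ℕ} (f : (Fin s → ℝ) → ℝ) : fourierCoef f 0 = integral f := by
  simp only [fourierCoef, neg_zero, expChar_zero, mul_one, integral]
  exact integral_ofReal

theorem hasSum_quadrature_sub_integral {α : ℝ} {γ : ℕ → ℝ} {N s : ℕ} (hN : 0 < N)
    (P : Fin N → Fin s → ℝ) {f : (Fin s → ℝ) → ℝ} (hf : MemKorobov α γ s f) :
    HasSum (fun h => fourierCoef f h * errCoef P h) ((quadrature P f - integral f : ℝ) : ℂ) := by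
  have h1 := (hasSum_sum (s := Finset.univ) fun n _ => hf.hasSum (P n)).mul_left (1 / (N : ℂ))
  have h2 := h1.sub (hasSum_ite_eq (0 : Fin s → ℤ) (fourierCoef f 0))
  rw [fourierCoef_zero] at h2
  have e1 : (fun h => fourierCoef f h * errCoef P h) = fun h =>
      1 / (N : ℂ) * ∑ n, fourierCoef f h * expChar h (P n) -
        if h = 0 then (integral f : ℂ) else 0 := by
    funext h
    rw [errCoef]
    split_ifs with hh
    · subst hh
      have : (N : ℂ) ≠ 0 := by exact_mod_cast hN.ne'
      simp [expChar_zero, fourierCoef_zero, this]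
    · rw [← Finset.mul_sum]
      ring
  have e2 : ((quadrature P f - integral f : ℝ) : ℂ) =
      1 / (N : ℂ) * ∑ n, (f (P n) : ℂ) - (integral f : ℂ) := by
    simp [quadrature]
  rw [e1, e2]
  exact h2

/-- Cauchy–Schwarz, after splitting each term of the error series as (|f̂| / √r) · (√r |errCoef|).
-/
theorem abs_quadrature_sub_integral_le {α : ℝ} (hα : 1 / 2 < α) {γ : ℕ → ℝ} (hγ : ∀ j, 0 < γ j)
    {N s : ℕ} (hN : 0 < N) (P : Fin N → Fin s → ℝ) {f : (Fin s → ℝ) → ℝ}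
    (hf : MemKorobov α γ s f) (hf1 : korobovNorm α γ f ≤ 1) :
    |quadrature P f - integral f| ≤ √(∑' h, r α γ h * ‖errCoef P h‖ ^ 2) := by
  have hs := hasSum_quadrature_sub_integral hN P hf
  have hn : ∀ h, ‖fourierCoef f h * errCoef P h‖ =
      (‖fourierCoef f h‖ / √(r α γ h)) * (√(r α γ h) * ‖errCoef P h‖) := fun h => by
    have : √(r α γ h) ≠ 0 := (Real.sqrt_pos.2 (r_pos α hγ h)).ne'
    rw [norm_mul]
    field_simp
  have e1 : ∀ h, (‖fourierCoef f h‖ / √(r α γ h)) ^ (2 : ℝ) = ‖fourierCoef f h‖ ^ 2 / r α γ h :=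
    fun h => by rw [Real.rpow_two, div_pow, Real.sq_sqrt (r_pos α hγ h).le]
  have e2 : ∀ h, (√(r α γ h) * ‖errCoef P h‖) ^ (2 : ℝ) = r α γ h * ‖errCoef P h‖ ^ 2 :=
    fun h => by rw [Real.rpow_two, mul_pow, Real.sq_sqrt (r_pos α hγ h).le]
  have hcs := Real.inner_le_Lp_mul_Lq_tsum_of_nonneg Real.HolderConjugate.two_two
    (f := fun h => ‖fourierCoef f h‖ / √(r α γ h)) (g := fun h => √(r α γ h) * ‖errCoef P h‖)
    (fun h => by positivity) (fun h => by positivity)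
    (by simpa only [e1] using hf.summable) (by simpa only [e2] using summable_r_mul_sq hα hγ P)
  simp_rw [e1, e2, ← hn, ← Real.sqrt_eq_rpow] at hcs
  calc |quadrature P f - integral f| = ‖((quadrature P f - integral f : ℝ) : ℂ)‖ := by
        rw [Complex.norm_real, Real.norm_eq_abs]
    _ ≤ ∑' h, ‖fourierCoef f h * errCoef P h‖ := by
        rw [← hs.tsum_eq]
        exact norm_tsum_le_tsum_norm hs.summable.norm
    _ ≤ _ := hcs
    _ ≤ _ := mul_le_of_le_one_left (Real.sqrt_nonneg _) hf1

/-- The equality case of Cauchy–Schwarz: the coefficients r(h) · conj(errCoef h), divided by √R to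
have norm one. -/
theorem exists_memKorobov_error_eq {α : ℝ} (hα : 1 / 2 < α) {γ : ℕ → ℝ} (hγ : ∀ j, 0 < γ j)
    {N s : ℕ} (hN : 0 < N) (P : Fin N → Fin s → ℝ)
    (hR : 0 < ∑' h, r α γ h * ‖errCoef P h‖ ^ 2) :
    ∃ f : (Fin s → ℝ) → ℝ, MemKorobov α γ s f ∧ korobovNorm α γ f ≤ 1 ∧
      quadrature P f - integral f = √(∑' h, r α γ h * ‖errCoef P h‖ ^ 2) := by
  have hRs := (summable_r_mul_sq hα hγ P).hasSum
  set R := ∑' h, r α γ h * ‖errCoef P h‖ ^ 2 with hRdef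
  have hsR : 0 < √R := Real.sqrt_pos.2 hR
  have hsR2 : √R ^ 2 = R := Real.sq_sqrt hR.le
  let c : (Fin s → ℤ) → ℂ := fun h => ((r α γ h / √R : ℝ) : ℂ) * starRingEnd ℂ (errCoef P h)
  have hcn : ∀ h, ‖c h‖ = r α γ h / √R * ‖errCoef P h‖ := fun h => by
    have := r_pos α hγ h
    rw [norm_mul, Complex.norm_real, Complex.norm_conj, Real.norm_of_nonneg (by positivity)]
  have hcs : Summable fun h => ‖c h‖ := by
    refine ((summable_r hα hγ s).div_const (√R)).of_nonneg_of_le (fun h => norm_nonneg _)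
      fun h => ?_
    have := r_pos α hγ h
    rw [hcn]
    exact mul_le_of_le_one_right (by positivity) (norm_errCoef_le P h)
  have hsx : ∀ x, Summable fun h => c h * expChar h x := fun x =>
    Summable.of_norm (by simpa only [norm_mul, norm_expChar, mul_one] using hcs)
  -- The series is real because r is even and `errCoef` is conjugated by h ↦ -h.
  have hconj : ∀ x, starRingEnd ℂ (∑' h, c h * expChar h x) = ∑' h, c h * expChar h x := by
    intro x
    rw [Complex.conj_tsum, ← (Equiv.neg (Fin s → ℤ)).tsum_eq]
    refine tsum_congr fun h => ?_
    simp only [Equiv.neg_apply, map_mul, c, r_neg, errCoef_neg, expChar_neg, Complex.conj_conj,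
      Complex.conj_ofReal]
  let f : (Fin s → ℝ) → ℝ := fun x => (∑' h, c h * expChar h x).re
  have hf : ∀ x, HasSum (fun h => c h * expChar h x) (f x : ℂ) := fun x => by
    have := (hsx x).hasSum
    rwa [← Complex.conj_eq_iff_re.1 (hconj x)] at this
  have hfc : ∀ h, fourierCoef f h = c h := fourierCoef_eq_of_hasSum hcs hf
  have hterm : ∀ h, ‖fourierCoef f h‖ ^ 2 / r α γ h = r α γ h * ‖errCoef P h‖ ^ 2 / R := fun h => by
    have := r_pos α hγ h
    rw [hfc, hcn, mul_pow, div_pow, hsR2]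
    field_simp
  have hmem : MemKorobov α γ s f :=
    ⟨fun x => by simpa only [hfc] using hf x, by
      simpa only [hterm] using hRs.summable.div_const R⟩
  refine ⟨f, hmem, ?_, ?_⟩
  · rw [korobovNorm]
    simp_rw [hterm]
    rw [(hRs.div_const R).tsum_eq, div_self hR.ne', Real.sqrt_one]
  · have h1 := hasSum_quadrature_sub_integral hN P hmem
    have h2 : HasSum (fun h => ((r α γ h * ‖errCoef P h‖ ^ 2 / √R : ℝ) : ℂ)) ((√R : ℝ) : ℂ) := by
      rw [Complex.hasSum_ofReal]
      have e : √R = R / √R := by rw [eq_div_iff hsR.ne', ← sq, hsR2]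
      have := hRs.div_const (√R)
      rwa [← e] at this
    have h3 : (fun h => fourierCoef f h * errCoef P h) =
        fun h => ((r α γ h * ‖errCoef P h‖ ^ 2 / √R : ℝ) : ℂ) := by
      funext h
      rw [hfc]
      simp only [c]
      rw [mul_assoc, Complex.conj_mul']
      push_cast
      ring
    rw [h3] at h1
    exact_mod_cast h1.unique h2

theorem worstCaseError_sq {α : ℝ} (hα : 1 / 2 < α) {γ : ℕ → ℝ} (hγ : ∀ j, 0 < γ j)
    {N s : ℕ} (hN : 0 < N) (P : Fin N → Fin s → ℝ) :
    worstCaseError α γ P ^ 2 = sqError α γ P := by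
  have h0 : 0 ≤ ∑' h, r α γ h * ‖errCoef P h‖ ^ 2 := tsum_nonneg fun h => by
    have := r_pos α hγ h
    positivity
  have key : worstCaseError α γ P =
      ENNReal.ofReal (√(∑' h, r α γ h * ‖errCoef P h‖ ^ 2)) := by
    refine le_antisymm ?_ ?_
    · exact iSup_le fun f => iSup_le fun hf => iSup_le fun hf1 =>
        ENNReal.ofReal_le_ofReal (abs_quadrature_sub_integral_le hα hγ hN P hf hf1)
    · rcases h0.eq_or_lt with hR | hR
      · simp [← hR]
      · obtain ⟨f, hf, hf1, he⟩ := exists_memKorobov_error_eq hα hγ hN P hR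
        refine le_trans ?_ (le_iSup_of_le f (le_iSup_of_le hf (le_iSup_of_le hf1 le_rfl)))
        rw [he]
        exact ENNReal.ofReal_le_ofReal (le_abs_self _)
  rw [key, sqError_eq hα hγ, ← ENNReal.ofReal_pow (Real.sqrt_nonneg _), Real.sq_sqrt h0]

/-! ### Lattice rules and the dual lattice. -/

theorem expChar_latticePoints (N : ℕ) {d : ℕ} (z : Fin d → ℕ) (h : Fin d → ℤ) (n : Fin N) :
    expChar h (latticePoints N z n) =
      Complex.exp (2 * Real.pi * Complex.I * (((∑ j, h j * z j : ℤ) : ℂ) / N)) ^ (n : ℕ) := by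
  rw [← Complex.exp_nat_mul, expChar, Complex.exp_eq_exp_iff_exists_int]
  -- Taking fractional parts shifts the phase by this integer, so the character values at the points
  -- are powers of one root of unity.
  refine ⟨-∑ j, h j * ⌊((n : ℕ) : ℝ) * (z j : ℝ) / (N : ℝ)⌋, ?_⟩
  have : ∑ j, (h j : ℝ) * latticePoints N z n j =
      (n : ℕ) * (((∑ j, h j * z j : ℤ) : ℝ) / N) -
        ((∑ j, h j * ⌊((n : ℕ) : ℝ) * (z j : ℝ) / (N : ℝ)⌋ : ℤ) : ℝ) := by
    push_cast
    rw [Finset.sum_div, Finset.mul_sum, ← Finset.sum_sub_distrib]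
    refine Finset.sum_congr rfl fun j _ => ?_
    rw [latticePoints, ← Int.self_sub_floor]
    ring
  rw [this]
  push_cast
  ring

theorem exp_two_pi_mul_div_eq_one_iff {N : ℕ} (hN : 0 < N) (a : ℤ) :
    Complex.exp (2 * Real.pi * Complex.I * ((a : ℂ) / N)) = 1 ↔ (N : ℤ) ∣ a := by
  have hN' : (N : ℂ) ≠ 0 := by exact_mod_cast hN.ne'
  rw [Complex.exp_eq_one_iff]
  constructor
  · rintro ⟨m, hm⟩
    refine ⟨m, ?_⟩
    rw [mul_comm] at hm
    have := mul_right_cancel₀ Complex.two_pi_I_ne_zero hm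
    rw [div_eq_iff hN'] at this
    rw [mul_comm]
    exact_mod_cast this
  · rintro ⟨m, rfl⟩
    refine ⟨m, ?_⟩
    push_cast
    field_simp

theorem errCoef_latticePoints {N : ℕ} (hN : 0 < N) {d : ℕ} (z : Fin d → ℕ) (h : Fin d → ℤ) :
    errCoef (latticePoints N z) h =
      if h = 0 then 0 else if (N : ℤ) ∣ ∑ j, h j * z j then 1 else 0 := by
  have hN' : (N : ℂ) ≠ 0 := by exact_mod_cast hN.ne'
  rw [errCoef]
  refine if_congr Iff.rfl rfl ?_
  simp_rw [expChar_latticePoints]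
  rw [Fin.sum_univ_eq_sum_range (fun n => Complex.exp (2 * Real.pi * Complex.I *
    (((∑ j, h j * z j : ℤ) : ℂ) / N)) ^ n)]
  split_ifs with hd
  · rw [(exp_two_pi_mul_div_eq_one_iff hN _).2 hd]
    simp [hN']
  · rw [geom_sum_eq (mt (exp_two_pi_mul_div_eq_one_iff hN _).1 hd), ← Complex.exp_nat_mul]
    have : Complex.exp (N * (2 * Real.pi * Complex.I * (((∑ j, h j * z j : ℤ) : ℂ) / N))) = 1 := by
      rw [Complex.exp_eq_one_iff]
      refine ⟨∑ j, h j * z j, ?_⟩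
      field_simp
    rw [this]
    simp

theorem sqError_latticePoints (α : ℝ) (γ : ℕ → ℝ) {N : ℕ} (hN : 0 < N) {d : ℕ} (z : Fin d → ℕ) :
    sqError α γ (latticePoints N z) =
      ∑' h : Fin d → ℤ, if h = 0 then 0 else
        if (N : ℤ) ∣ ∑ j, h j * z j then ENNReal.ofReal (r α γ h) else 0 := by
  rw [sqError]
  refine tsum_congr fun h => ?_
  rw [errCoef_latticePoints hN]
  split_ifs <;> simp

/-- The increase of the squared worst-case error of a lattice rule when a component is appended. -/
noncomputable def cbcIncrement (α : ℝ) (γ : ℕ → ℝ) (N : ℕ) {d : ℕ} (z : Fin d → ℕ) (w : ℕ) :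
    ℝ≥0∞ :=
  ∑' (h : Fin d → ℤ) (k : ℤ), if k = 0 then 0 else
    if (N : ℤ) ∣ ∑ j, h j * z j + k * w then ENNReal.ofReal (r α γ h * (γ d / |(k : ℝ)| ^ (2 * α)))
      else 0

/-- Dual vectors with last entry zero are those of the shorter lattice; the remaining ones make up
the increment. -/
theorem sqError_latticePoints_snoc (α : ℝ) (γ : ℕ → ℝ) {N : ℕ} (hN : 0 < N) {d : ℕ}
    (z : Fin d → ℕ) (w : ℕ) :
    sqError α γ (latticePoints N (Fin.snoc (α := fun _ => ℕ) z w)) =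
      sqError α γ (latticePoints N z) + cbcIncrement α γ N z w := by
  have hsnoc : ∀ (h : Fin d → ℤ) (k : ℤ), Fin.snoc (α := fun _ => ℤ) h k = 0 ↔ h = 0 ∧ k = 0 := by
    intro h k
    constructor
    · intro e
      refine ⟨funext fun i => ?_, ?_⟩
      · simpa using congr_fun e i.castSucc
      · simpa using congr_fun e (Fin.last d)
    · rintro ⟨rfl, rfl⟩
      funext i
      refine Fin.lastCases ?_ (fun i => ?_) i <;> simp
  rw [sqError_latticePoints α γ hN, sqError_latticePoints α γ hN, tsum_snoc, cbcIncrement,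
    ← ENNReal.tsum_add]
  refine tsum_congr fun h => ?_
  rw [tsum_int_eq_zero_add]
  congr 1
  · simp [hsnoc, Fin.sum_univ_castSucc, r_snoc]
  · refine tsum_congr fun k => ?_
    by_cases hk : k = 0
    · simp [hk]
    · simp [hk, hsnoc, Fin.sum_univ_castSucc, r_snoc]

/-! ### Averaging over units and the component-by-component bound. -/

theorem sum_rpow_le {ι : Type*} (s : Finset ι) (f : ι → ℝ≥0∞) {p : ℝ} (hp0 : 0 < p)
    (hp1 : p ≤ 1) : (∑ i ∈ s, f i) ^ p ≤ ∑ i ∈ s, f i ^ p := by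
  classical
  induction s using Finset.induction_on with
  | empty => simp [hp0]
  | insert a s ha ih =>
    rw [Finset.sum_insert ha, Finset.sum_insert ha]
    exact (ENNReal.rpow_add_le_add_rpow _ _ hp0.le hp1).trans (by gcongr)

theorem tsum_rpow_le {ι : Type*} (f : ι → ℝ≥0∞) {p : ℝ} (hp0 : 0 < p) (hp1 : p ≤ 1) :
    (∑' i, f i) ^ p ≤ ∑' i, f i ^ p := by
  have h : HasSum f (∑' i, f i) := ENNReal.summable.hasSum
  have h2 := ((ENNReal.continuous_rpow_const (y := p)).tendsto _).comp h
  exact le_of_tendsto h2 (Filter.Eventually.of_forall fun s =>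
    (sum_rpow_le s f hp0 hp1).trans (ENNReal.sum_le_tsum s))

/-- The numbers below `N` which are coprime to `N`. -/
def units (N : ℕ) : Finset ℕ := (Finset.range N).filter fun w => N.Coprime w

theorem card_units (N : ℕ) : (units N).card = N.totient := rfl

/-- One solution w₀ already forces gcd(a, N) to divide k w₀, hence k, as w₀ is a unit. Any two
solutions agree modulo N / gcd(N, k), so there are at most gcd(N, k) of them below N; this number
divides both N and a, so it is at most gcd(a, N). -/
theorem card_filter_units_dvd_le {N : ℕ} (hN : 0 < N) (a k : ℤ) :
    ((units N).filter fun w : ℕ => (N : ℤ) ∣ a + k * w).card ≤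
      if (Int.gcd a N : ℤ) ∣ k then Int.gcd a N else 0 := by
  have hN' : (0 : ℤ) < N := by exact_mod_cast hN
  rcases ((units N).filter fun w : ℕ => (N : ℤ) ∣ a + k * w).eq_empty_or_nonempty with he | ⟨w₀, hw₀⟩
  · rw [he]; simp
  rw [units, Finset.mem_filter, Finset.mem_filter, Finset.mem_range] at hw₀
  obtain ⟨⟨-, hcop⟩, hdvd⟩ := hw₀
  have hgk : (Int.gcd a N : ℤ) ∣ k := by
    have h1 : (Int.gcd a N : ℤ) ∣ k * w₀ :=
      (dvd_add_right (Int.gcd_dvd_left a N)).1 ((Int.gcd_dvd_right a N).trans hdvd)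
    refine IsCoprime.dvd_of_dvd_mul_right ?_ h1
    exact IsCoprime.of_isCoprime_of_dvd_left (Nat.isCoprime_iff_coprime.2 hcop)
      (Int.gcd_dvd_right a N)
  rw [if_pos hgk]
  set g := Int.gcd N k with hg
  have hgN : (g : ℤ) ∣ N := Int.gcd_dvd_left _ _
  have hgk' : (g : ℤ) ∣ k := Int.gcd_dvd_right _ _
  have hga : (g : ℤ) ∣ a := (dvd_add_left (hgk'.mul_right _)).1 (hgN.trans hdvd)
  have hle : g ≤ Int.gcd a N :=
    Nat.le_of_dvd (Int.gcd_pos_of_ne_zero_right _ hN'.ne')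
      (Int.natCast_dvd_natCast.1 (Int.dvd_coe_gcd hga hgN))
  refine le_trans ?_ hle
  obtain ⟨M, hM⟩ : g ∣ N := Int.natCast_dvd_natCast.1 hgN
  have hM0 : 0 < M := Nat.pos_of_ne_zero fun h => by simp [h] at hM; omega
  have hg0 : 0 < g := Nat.pos_of_ne_zero fun h => by simp [h] at hM; omega
  have hdiv : (N : ℤ) / Int.gcd N k = M := by
    rw [← hg, hM]; push_cast
    exact Int.mul_ediv_cancel_left _ (by exact_mod_cast hg0.ne')
  rw [← Finset.card_range g]
  -- Solutions share their residue modulo M, so the quotient by M determines them, and it is below g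
  -- since w < g M.
  refine Finset.card_le_card_of_injOn (fun w => w / M) (fun w hw => ?_) ?_
  · simp only [units, Finset.coe_filter, Finset.mem_filter, Finset.mem_range,
      Set.mem_ofPred_eq] at hw
    simp only [Finset.coe_range, Set.mem_Iio]
    rw [Nat.div_lt_iff_lt_mul hM0, ← hM]
    exact hw.1.1
  · intro w hw v hv hwv
    simp only [Finset.coe_filter, Set.mem_ofPred_eq] at hw hv hwv
    have h1 : k * w ≡ k * v [ZMOD N] := by
      rw [Int.modEq_iff_dvd]
      have := dvd_sub hv.2 hw.2
      rwa [add_sub_add_left_eq_sub] at this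
    have h2 := Int.ModEq.cancel_left_div_gcd hN' h1
    rw [hdiv, Int.natCast_modEq_iff] at h2
    rw [← Nat.div_add_mod w M, ← Nat.div_add_mod v M, hwv, h2]

/-- With g = gcd(a, N), each multiple k of g is counted at most g times and the sum over those
multiples carries g^(-p). Since g · g^(-p) ≤ 1, the bound does not depend on a. -/
theorem tsum_count_le {N : ℕ} (hN : 0 < N) {c p : ℝ} (hc : 0 ≤ c) (hp : 1 < p) (a : ℤ) :
    ∑ w ∈ units N, ∑' k : ℤ, (if k = 0 then 0 else
      if (N : ℤ) ∣ a + k * w then ENNReal.ofReal (c / |(k : ℝ)| ^ p) else 0) ≤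
      ENNReal.ofReal (2 * c * realZeta p) := by
  have hz := realZeta_nonneg hp
  rw [← Summable.tsum_finsetSum fun _ _ => ENNReal.summable]
  set g := Int.gcd a N with hg
  have hg0 : 0 < g := Int.gcd_pos_of_ne_zero_right _ (by exact_mod_cast hN.ne')
  have hg1 : (1 : ℝ) ≤ g := by exact_mod_cast hg0
  calc _ ≤ ∑' k : ℤ, (g : ℝ≥0∞) * (if k = 0 then 0 else
        if (g : ℤ) ∣ k then ENNReal.ofReal (c / |(k : ℝ)| ^ p) else 0) := by
        refine ENNReal.tsum_le_tsum fun k => ?_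
        by_cases hk : k = 0
        · simp [hk]
        · simp_rw [if_neg hk]
          rw [← Finset.sum_filter, Finset.sum_const, nsmul_eq_mul]
          have := card_filter_units_dvd_le hN a k
          rw [← hg] at this
          split_ifs with hd
          · rw [if_pos hd] at this
            gcongr
          · rw [if_neg hd, Nat.le_zero] at this
            simp [this]
    _ = ENNReal.ofReal ((g : ℝ) * (2 * c * realZeta p / (g : ℝ) ^ p)) := by
        rw [ENNReal.tsum_mul_left, tsum_int_dvd_div_rpow hp hc hg0,
          ENNReal.ofReal_mul (by positivity), ENNReal.ofReal_natCast]
    _ ≤ _ := by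
        refine ENNReal.ofReal_le_ofReal ?_
        have h1 : (g : ℝ) ≤ (g : ℝ) ^ p := Real.self_le_rpow_of_one_le hg1 hp.le
        rw [← mul_div_assoc, div_le_iff₀ (by positivity), mul_comm]
        gcongr

theorem sum_cbcIncrement_rpow_le {α lam : ℝ} (hα : 1 / 2 < α) (hlam : 1 / (2 * α) < lam)
    (hlam1 : lam ≤ 1) {γ : ℕ → ℝ} (hγ : ∀ j, 0 < γ j) {N : ℕ} (hN : 0 < N) {d : ℕ}
    (z : Fin d → ℕ) :
    ∑ w ∈ units N, cbcIncrement α γ N z w ^ lam ≤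
      ENNReal.ofReal (rSum (α * lam) (fun j => γ j ^ lam) d) *
        ENNReal.ofReal (2 * γ d ^ lam * realZeta (2 * (α * lam))) := by
  have hlam0 : 0 < lam := lt_trans (by positivity) hlam
  have hp : 1 < 2 * (α * lam) := by
    rw [div_lt_iff₀ (by positivity)] at hlam
    linarith
  have hterm (w : ℕ) : cbcIncrement α γ N z w ^ lam ≤ ∑' h : Fin d → ℤ,
      ENNReal.ofReal (r (α * lam) (fun j => γ j ^ lam) h) * ∑' k : ℤ, (if k = 0 then 0 else
        if (N : ℤ) ∣ ∑ j, h j * z j + k * w then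
          ENNReal.ofReal (γ d ^ lam / |(k : ℝ)| ^ (2 * (α * lam))) else 0) := by
    refine (tsum_rpow_le _ hlam0 hlam1).trans (ENNReal.tsum_le_tsum fun h => ?_)
    refine (tsum_rpow_le _ hlam0 hlam1).trans ?_
    rw [← ENNReal.tsum_mul_left]
    refine ENNReal.tsum_le_tsum fun k => ?_
    have h1 := r_pos α hγ h
    have h2 := hγ d
    split_ifs
    · simp [hlam0]
    · rw [ENNReal.ofReal_rpow_of_nonneg (by positivity) hlam0.le,
        Real.mul_rpow h1.le (by positivity), r_rpow α hγ, Real.div_rpow h2.le (by positivity),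
        ← Real.rpow_mul (abs_nonneg _), ← ENNReal.ofReal_mul, mul_assoc]
      exact (r_pos _ (fun j => Real.rpow_pos_of_pos (hγ j) _) h).le
    · simp [hlam0]
  refine (Finset.sum_le_sum fun w _ => hterm w).trans ?_
  rw [← Summable.tsum_finsetSum fun _ _ => ENNReal.summable,
    ← tsum_r (by linarith) (fun j => Real.rpow_pos_of_pos (hγ j) _), ← ENNReal.tsum_mul_right]
  refine ENNReal.tsum_le_tsum fun h => ?_
  rw [← Finset.mul_sum]
  gcongr
  exact tsum_count_le hN (Real.rpow_nonneg (hγ d).le _) hp _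

theorem sqError_ne_top {α : ℝ} (hα : 1 / 2 < α) {γ : ℕ → ℝ} (hγ : ∀ j, 0 < γ j) {N s : ℕ}
    (P : Fin N → Fin s → ℝ) : sqError α γ P ≠ ∞ := by
  rw [sqError_eq hα hγ]
  exact ENNReal.ofReal_ne_top

theorem castLE_succ_eq_snoc {d j : ℕ} (z : Fin d → ℕ) (hj : j < d) :
    (fun i : Fin (j + 1) => z (Fin.castLE hj i)) =
      Fin.snoc (α := fun _ => ℕ) (fun i : Fin j => z (Fin.castLE hj.le i)) (z ⟨j, hj⟩) := by
  funext i
  refine Fin.lastCases ?_ (fun i => ?_) i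
  · simp only [Fin.snoc_last]
    rfl
  · simp only [Fin.snoc_castSucc]
    rfl

/-- For N > 1 every unit is among the candidates 1, …, N - 1, and the error of the preceding
components is common to both sides. -/
theorem cbcIncrement_le_of_isCBC {α : ℝ} (hα : 1 / 2 < α) {γ : ℕ → ℝ} (hγ : ∀ j, 0 < γ j)
    {N d : ℕ} (hN : 1 < N) {z : Fin d → ℕ} (hz : IsCBC α γ N d z) {j : ℕ} (hj : j < d) {w : ℕ}
    (hw : w ∈ units N) :
    cbcIncrement α γ N (fun i : Fin j => z (Fin.castLE hj.le i)) (z ⟨j, hj⟩) ≤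
      cbcIncrement α γ N (fun i : Fin j => z (Fin.castLE hj.le i)) w := by
  have hN0 : 0 < N := by omega
  rw [units, Finset.mem_filter, Finset.mem_range] at hw
  rcases Nat.eq_zero_or_pos j with rfl | hj0
  -- The first component is fixed rather than minimized. With no earlier frequency the condition for
  -- 1 is N ∣ k, which implies N ∣ k w.
  · rw [hz.first ⟨0, hj⟩ rfl]
    refine ENNReal.tsum_le_tsum fun h => ENNReal.tsum_le_tsum fun k => ?_
    by_cases hk : (N : ℤ) ∣ k
    · simp [hk, hk.mul_right]
    · simp [hk]
  · have hw0 : w ≠ 0 := by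
      rintro rfl
      have := (Nat.coprime_zero_right N).1 hw.2
      omega
    have h := hz.step j hj hj0 w (Finset.mem_Icc.2 ⟨by omega, by omega⟩)
    rw [worstCaseError_sq hα hγ hN0, worstCaseError_sq hα hγ hN0, castLE_succ_eq_snoc,
      sqError_latticePoints_snoc α γ hN0, sqError_latticePoints_snoc α γ hN0] at h
    exact (ENNReal.add_le_add_iff_left (sqError_ne_top hα hγ _)).1 h

/-- The added 1 makes the induction close: the increment costs at most 2γ_j^λ ζ(2αλ) times the
product so far, which supplies the next factor. -/
theorem totient_mul_sqError_rpow_le {α lam : ℝ} (hα : 1 / 2 < α) (hlam : 1 / (2 * α) < lam)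
    (hlam1 : lam ≤ 1) {γ : ℕ → ℝ} (hγ : ∀ j, 0 < γ j) {N d : ℕ} (hN : 1 < N) {z : Fin d → ℕ}
    (hz : IsCBC α γ N d z) (j : ℕ) (hj : j ≤ d) :
    (N.totient : ℝ≥0∞) *
        sqError α γ (latticePoints N fun i : Fin j => z (Fin.castLE hj i)) ^ lam + 1 ≤
      ENNReal.ofReal (rSum (α * lam) (fun j => γ j ^ lam) j) := by
  have hN0 : 0 < N := by omega
  have hlam0 : 0 < lam := lt_trans (by positivity) hlam
  have hp : 1 / 2 < α * lam := by
    rw [div_lt_iff₀ (by positivity)] at hlam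
    linarith
  have hγ' : ∀ j, 0 < γ j ^ lam := fun j => Real.rpow_pos_of_pos (hγ j) _
  induction j with
  | zero =>
    rw [sqError_latticePoints α γ hN0]
    have h0 : ∀ h : Fin 0 → ℤ, h = 0 := fun h => Subsingleton.elim _ _
    simp_rw [if_pos (h0 _)]
    simp [rSum, hlam0]
  | succ j ih =>
    rw [castLE_succ_eq_snoc, sqError_latticePoints_snoc α γ hN0]
    have h1 := (Finset.sum_le_sum fun w hw => ENNReal.rpow_le_rpow
      (cbcIncrement_le_of_isCBC hα hγ hN hz hj hw) hlam0.le).trans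
      (sum_cbcIncrement_rpow_le hα hlam hlam1 hγ hN0 _)
    rw [Finset.sum_const, card_units, nsmul_eq_mul] at h1
    have hz0 := realZeta_nonneg (x := 2 * (α * lam)) (by linarith)
    have hr := one_le_rSum hp hγ' j
    have hγj := hγ' j
    calc _ ≤ (N.totient : ℝ≥0∞) * (_ ^ lam + _ ^ lam) + 1 := by
          gcongr
          exact ENNReal.rpow_add_le_add_rpow _ _ hlam0.le hlam1
      _ = ((N.totient : ℝ≥0∞) * _ ^ lam + 1) + (N.totient : ℝ≥0∞) * _ ^ lam := by ring
      _ ≤ _ := add_le_add (ih (Nat.le_of_succ_le hj)) h1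
      _ = _ := by
          rw [← ENNReal.ofReal_mul (by linarith), ← ENNReal.ofReal_add (by linarith)
            (by positivity), rSum, rSum, Finset.prod_range_succ]
          congr 1
          ring

/-! ### Second moments at the random points. -/

theorem integral_norm_sum_sq {Ω : Type*} [MeasurableSpace Ω] {μ : Measure Ω}
    [IsProbabilityMeasure μ] {N : ℕ} {a : Fin N → Ω → ℂ} (hm : ∀ n, Measurable (a n))
    (h1 : ∀ n ω, ‖a n ω‖ = 1)
    (h0 : ∀ n m, n ≠ m → ∫ ω, a n ω * starRingEnd ℂ (a m ω) ∂μ = 0) :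
    ∫ ω, ‖∑ n, a n ω‖ ^ 2 ∂μ = N := by
  have hint : ∀ n m, Integrable (fun ω => a n ω * starRingEnd ℂ (a m ω)) μ := fun n m => by
    refine Integrable.of_bound (C := 1) ?_ (ae_of_all _ fun ω => ?_)
    · exact ((hm n).mul (Complex.continuous_conj.measurable.comp (hm m))).aestronglyMeasurable
    · rw [norm_mul, Complex.norm_conj, h1, h1, one_mul]
  have hd : ∀ n m, ∫ ω, a n ω * starRingEnd ℂ (a m ω) ∂μ = if n = m then 1 else 0 := by
    intro n m
    split_ifs with hnm
    · subst hnm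
      simp [Complex.mul_conj', h1]
    · exact h0 n m hnm
  have : ((∫ ω, ‖∑ n, a n ω‖ ^ 2 ∂μ : ℝ) : ℂ) = (N : ℂ) := by
    rw [← integral_complex_ofReal]
    have e : ∀ ω, ((‖∑ n, a n ω‖ ^ 2 : ℝ) : ℂ) = ∑ n, ∑ m, a n ω * starRingEnd ℂ (a m ω) := by
      intro ω
      rw [Complex.ofReal_pow, ← Complex.mul_conj', map_sum, Finset.sum_mul_sum]
    simp_rw [e]
    rw [integral_finsetSum _ fun n _ => integrable_finsetSum _ fun m _ => hint n m]
    simp_rw [integral_finsetSum _ fun m _ => hint _ m, hd]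
    simp
  exact_mod_cast this

theorem integral_exp_of_isUniform {Ω : Type*} [MeasurableSpace Ω] {μ : Measure Ω}
    {Y : Ω → ℝ} (hm : Measurable Y) (hY : pdf.IsUniform Y (Set.Ico 0 1) μ volume) {k : ℤ}
    (hk : k ≠ 0) :
    ∫ ω, Complex.exp (2 * Real.pi * Complex.I * ((k * Y ω : ℝ) : ℂ)) ∂μ = 0 := by
  have h := integral_Ico_exp k
  rw [if_neg hk] at h
  have hmap : μ.map Y = volume.restrict (Set.Ico 0 1) := by
    rw [hY, ProbabilityTheory.cond]
    simp
  rw [← hmap, integral_map hm.aemeasurable] at h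
  · exact h
  · exact Measurable.aestronglyMeasurable (by fun_prop)

section Random

variable {Ω : Type*} [MeasurableSpace Ω] {μ : Measure Ω} {N s d : ℕ}
  {X : Fin N → {j : Fin s // d ≤ (j : ℕ)} → Ω → ℝ}

theorem measurable_concatPoints (hm : ∀ n j, Measurable (X n j)) (z : Fin d → ℕ) (n : Fin N) :
    Measurable fun ω => concatPoints z (fun n j => X n j ω) n := by
  refine measurable_pi_lambda _ fun j => ?_
  simp only [concatPoints]
  split_ifs with hj
  · exact measurable_const
  · exact hm _ _

theorem measurable_errCoef_concatPoints (hm : ∀ n j, Measurable (X n j)) (z : Fin d → ℕ)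
    (h : Fin s → ℤ) : Measurable fun ω => errCoef (concatPoints z fun n j => X n j ω) h := by
  simp only [errCoef]
  split_ifs
  · exact measurable_const
  · exact measurable_const.mul (Finset.measurable_sum _ fun n _ =>
      (continuous_expChar h).measurable.comp (measurable_concatPoints hm z n))

theorem measurable_sqError_concatPoints (hm : ∀ n j, Measurable (X n j)) (z : Fin d → ℕ)
    (α : ℝ) (γ : ℕ → ℝ) :
    Measurable fun ω => sqError α γ (concatPoints z fun n j => X n j ω) :=
  Measurable.tsum fun h => 
    (((measurable_errCoef_concatPoints hm z h).norm.pow_const 2).const_mul _).ennreal_ofReal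

/-- The lattice coordinates are deterministic and contribute only a constant. -/
theorem expChar_concatPoints (z : Fin d → ℕ) (h : Fin s → ℤ) (n : Fin N) :
    ∃ c : ℂ, ∀ x : Fin N → {j : Fin s // d ≤ (j : ℕ)} → ℝ,
      expChar h (concatPoints z x n) = c * ∏ j : {j : Fin s // d ≤ (j : ℕ)},
        Complex.exp (2 * Real.pi * Complex.I * ((h j * x n j : ℝ) : ℂ)) := by
  refine ⟨∏ j : {j : Fin s // ¬ d ≤ (j : ℕ)}, Complex.exp (2 * Real.pi * Complex.I *
    ((h j * latticePoints N z n ⟨j, not_le.1 j.2⟩ : ℝ) : ℂ)), fun x => ?_⟩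
  rw [expChar_eq_prod, ← Fintype.prod_subtype_mul_prod_subtype (fun j : Fin s => d ≤ (j : ℕ)),
    mul_comm]
  congr 1
  · refine Finset.prod_congr rfl fun j _ => ?_
    rw [concatPoints, dif_pos (not_le.1 j.2)]
  · refine Finset.prod_congr rfl fun j _ => ?_
    rw [concatPoints, dif_neg (not_lt.2 j.2)]

theorem integral_expChar_mul_conj [IsProbabilityMeasure μ] (hm : ∀ n j, Measurable (X n j))
    (hu : ∀ n j, pdf.IsUniform (X n j) (Set.Ico 0 1) μ volume)
    (hi : iIndepFun (fun p : Fin N × {j : Fin s // d ≤ (j : ℕ)} => X p.1 p.2) μ)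
    (z : Fin d → ℕ) {h : Fin s → ℤ} (hh : ∃ j : {j : Fin s // d ≤ (j : ℕ)}, h j ≠ 0)
    {n m : Fin N} (hnm : n ≠ m) :
    ∫ ω, expChar h (concatPoints z (fun n j => X n j ω) n) *
      starRingEnd ℂ (expChar h (concatPoints z (fun n j => X n j ω) m)) ∂μ = 0 := by
  obtain ⟨j₀, hj₀⟩ := hh
  obtain ⟨c, hc⟩ := expChar_concatPoints z h n
  obtain ⟨c', hc'⟩ := expChar_concatPoints z h m
  let e : {j : Fin s // d ≤ (j : ℕ)} → ℝ → ℂ := fun j y =>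
    Complex.exp (2 * Real.pi * Complex.I * ((h j * y : ℝ) : ℂ))
  -- The product of two characters becomes one product over all random variables: point n supplies
  -- e, point m its conjugate, and every other point the factor 1. Independence then applies to the
  -- whole family.
  let f : Fin N × {j : Fin s // d ≤ (j : ℕ)} → ℝ → ℂ := fun p =>
    if p.1 = n then e p.2 else if p.1 = m then fun y => starRingEnd ℂ (e p.2 y) else fun _ => 1
  have he : ∀ j, Continuous (e j) := fun j => by fun_prop
  have hf : ∀ p, Continuous (f p) := fun p => by
    simp only [f]
    split_ifs
    · exact he _
    · exact Complex.continuous_conj.comp (he _)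
    · exact continuous_const
  have hprod : ∀ ω, expChar h (concatPoints z (fun n j => X n j ω) n) *
      starRingEnd ℂ (expChar h (concatPoints z (fun n j => X n j ω) m)) =
      c * starRingEnd ℂ c' * ∏ p, f p (X p.1 p.2 ω) := by
    intro ω
    rw [hc, hc', Fintype.prod_prod_type, Fintype.prod_eq_mul n m hnm]
    · simp only [f, if_true, if_neg hnm.symm, map_mul, map_prod]
      simp only [e]
      ring
    · rintro i ⟨h1, h2⟩
      simp [f, h1, h2]
  simp_rw [hprod]
  rw [integral_const_mul, hi.integral_fun_prod_comp (fun p => (hm p.1 p.2).aemeasurable)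
    (fun p => (hf p).aestronglyMeasurable)]
  rw [Finset.prod_eq_zero (Finset.mem_univ (n, j₀)), mul_zero]
  simp only [f, if_true]
  exact integral_exp_of_isUniform (hm n j₀) (hu n j₀) hj₀

theorem lintegral_errCoef_concatPoints [IsProbabilityMeasure μ] (hN : 0 < N)
    (hm : ∀ n j, Measurable (X n j))
    (hu : ∀ n j, pdf.IsUniform (X n j) (Set.Ico 0 1) μ volume)
    (hi : iIndepFun (fun p : Fin N × {j : Fin s // d ≤ (j : ℕ)} => X p.1 p.2) μ)
    (z : Fin d → ℕ) {h : Fin s → ℤ} (hh : ∃ j : {j : Fin s // d ≤ (j : ℕ)}, h j ≠ 0)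
    {c : ℝ} (hc : 0 ≤ c) :
    ∫⁻ ω, ENNReal.ofReal (c * ‖errCoef (concatPoints z fun n j => X n j ω) h‖ ^ 2) ∂μ =
      ENNReal.ofReal (c * (1 / N)) := by
  have hh0 : h ≠ 0 := by
    rintro rfl
    obtain ⟨j, hj⟩ := hh
    exact hj rfl
  rw [← ofReal_integral_eq_lintegral_ofReal, integral_const_mul]
  · congr 2
    have e : ∀ ω, ‖errCoef (concatPoints z fun n j => X n j ω) h‖ ^ 2 =
        (1 / (N : ℝ)) ^ 2 * ‖∑ n, expChar h (concatPoints z (fun n j => X n j ω) n)‖ ^ 2 := by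
      intro ω
      rw [errCoef, if_neg hh0, norm_mul, mul_pow, norm_div, norm_one, Complex.norm_natCast]
    simp_rw [e]
    rw [integral_const_mul, integral_norm_sum_sq
      (a := fun n ω => expChar h (concatPoints z (fun n j => X n j ω) n))
      (fun n => (continuous_expChar h).measurable.comp (measurable_concatPoints hm z n))
      (fun n ω => norm_expChar _ _)
      (fun n m hnm => integral_expChar_mul_conj hm hu hi z hh hnm)]
    have : (N : ℝ) ≠ 0 := by positivity
    field_simp
  · refine Integrable.of_bound (C := c)
      (((measurable_errCoef_concatPoints hm z h).norm.pow_const 2).const_mul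
        _).aestronglyMeasurable (ae_of_all _ fun ω => ?_)
    rw [Real.norm_of_nonneg (by positivity)]
    exact mul_le_of_le_one_right hc (pow_le_one₀ (norm_nonneg _) (norm_errCoef_le _ _))
  · exact ae_of_all _ fun ω => by simp only [Pi.zero_apply]; positivity

end Random

/-! ### Splitting the expected squared error. -/

theorem append_eq_zero_iff {d t : ℕ} (a : Fin d → ℤ) (b : Fin t → ℤ) :
    Fin.append a b = 0 ↔ a = 0 ∧ b = 0 := by
  constructor
  · intro e
    exact ⟨funext fun i => by simpa using congr_fun e (Fin.castAdd t i),
      funext fun i => by simpa using congr_fun e (Fin.natAdd d i)⟩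
  · rintro ⟨rfl, rfl⟩
    funext i
    refine Fin.addCases (fun i => ?_) (fun i => ?_) i <;> simp

theorem errCoef_concatPoints_append_zero {N d t : ℕ} (z : Fin d → ℕ)
    (x : Fin N → {j : Fin (d + t) // d ≤ (j : ℕ)} → ℝ) (a : Fin d → ℤ) :
    errCoef (concatPoints z x) (Fin.append a 0) = errCoef (latticePoints N z) a := by
  rw [errCoef, errCoef]
  refine if_congr (by simp [append_eq_zero_iff]) rfl ?_
  congr 1
  refine Finset.sum_congr rfl fun n _ => ?_
  rw [expChar, expChar, Fin.sum_univ_add]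
  simp [concatPoints]

theorem tsum_r_tail {α : ℝ} (hα : 1 / 2 < α) {γ : ℕ → ℝ} (hγ : ∀ j, 0 < γ j) (t : ℕ) :
    ∑' b : Fin t → ℤ, (if b = 0 then 0 else ENNReal.ofReal (r α γ b)) =
      ENNReal.ofReal (rSum α γ t - 1) := by
  classical
  have h1 := one_le_rSum hα hγ t
  have h := tsum_r hα hγ t
  rw [ENNReal.tsum_eq_add_tsum_ite 0, r_zero, ENNReal.ofReal_one,
    show rSum α γ t = 1 + (rSum α γ t - 1) by ring, ENNReal.ofReal_add zero_le_one (by linarith),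
    ENNReal.ofReal_one, ENNReal.add_right_inj ENNReal.one_ne_top] at h
  rw [← h]
  exact tsum_congr fun b => by split_ifs <;> rfl

theorem lintegral_sqError_concatPoints {Ω : Type*} [MeasurableSpace Ω] {μ : Measure Ω}
    [IsProbabilityMeasure μ] {N d t : ℕ} (hN : 0 < N)
    {X : Fin N → {j : Fin (d + t) // d ≤ (j : ℕ)} → Ω → ℝ} (hm : ∀ n j, Measurable (X n j))
    (hu : ∀ n j, pdf.IsUniform (X n j) (Set.Ico 0 1) μ volume)
    (hi : iIndepFun (fun p : Fin N × {j : Fin (d + t) // d ≤ (j : ℕ)} => X p.1 p.2) μ)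
    (z : Fin d → ℕ) {α : ℝ} (hα : 1 / 2 < α) {γ : ℕ → ℝ} (hγ : ∀ j, 0 < γ j) :
    ∫⁻ ω, sqError α γ (concatPoints z fun n j => X n j ω) ∂μ =
      sqError α γ (latticePoints N z) +
        ENNReal.ofReal (1 / N * rSum α γ d * (rSum α (fun j => γ (d + j)) t - 1)) := by
  classical
  have hγ' : ∀ j, 0 < γ (d + j) := fun j => hγ _
  have hrd := one_le_rSum hα hγ d
  have hrt := one_le_rSum hα hγ' t
  simp only [sqError]
  rw [lintegral_tsum fun h => ((((measurable_errCoef_concatPoints hm z h).norm.pow_const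
    2).const_mul _).ennreal_ofReal).aemeasurable, tsum_append]
  have key : ∀ a : Fin d → ℤ, ∑' b : Fin t → ℤ, ∫⁻ ω, ENNReal.ofReal (r α γ (Fin.append a b) *
      ‖errCoef (concatPoints z fun n j => X n j ω) (Fin.append a b)‖ ^ 2) ∂μ =
      ENNReal.ofReal (r α γ a * ‖errCoef (latticePoints N z) a‖ ^ 2) +
        ENNReal.ofReal (r α γ a) *
          ENNReal.ofReal (1 / N * (rSum α (fun j => γ (d + j)) t - 1)) := by
    intro a
    have hra := r_pos α hγ a
    -- The tail b = 0 gives the lattice term; every b ≠ 0 meets a random coordinate and has mean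
    -- square 1/N.
    rw [ENNReal.tsum_eq_add_tsum_ite 0]
    congr 1
    · simp_rw [errCoef_concatPoints_append_zero, r_append, r_zero, mul_one]
      simp
    · rw [ENNReal.ofReal_mul (by positivity), ← tsum_r_tail hα hγ' t, ← ENNReal.tsum_mul_left,
        ← ENNReal.tsum_mul_left]
      refine tsum_congr fun b => ?_
      split_ifs with hb
      · simp
      · obtain ⟨i, hi0⟩ := Function.ne_iff.1 hb
        have hrb := r_pos α hγ' b
        rw [lintegral_errCoef_concatPoints hN hm hu hi z
          ⟨⟨Fin.natAdd d i, by simp⟩, by simpa using hi0⟩ (r_pos α hγ _).le, r_append,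
          ← ENNReal.ofReal_mul (by positivity), ← ENNReal.ofReal_mul hra.le]
        congr 1
        ring
  simp_rw [key]
  rw [ENNReal.tsum_add, ENNReal.tsum_mul_right, tsum_r hα hγ, ← ENNReal.ofReal_mul (by linarith)]
  congr 2
  ring

/-! ### Decay of the weights and exponential bounds. -/

/-- The j + 1 weights up to index j are all at least γ j, so (j + 1) γ_j^l is at most the whole sum.
-/
theorem le_div_rpow_of_antitone {γ : ℕ → ℝ} (hγ : ∀ j, 0 < γ j) (hmono : Antitone γ) {l : ℝ}
    (hl : 0 < l) (hs : Summable fun j => γ j ^ l) (j : ℕ) :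
    γ j ≤ (∑' i, γ i ^ l) ^ (1 / l) / ((j : ℝ) + 1) ^ (1 / l) := by
  have hpos : ∀ i, 0 ≤ γ i ^ l := fun i => Real.rpow_nonneg (hγ i).le _
  have h1 : ((j : ℝ) + 1) * γ j ^ l ≤ ∑' i, γ i ^ l := by
    refine le_trans ?_ (hs.sum_le_tsum (Finset.range (j + 1)) fun i _ => hpos i)
    have := Finset.card_nsmul_le_sum (Finset.range (j + 1)) (fun i => γ i ^ l) (γ j ^ l)
      fun i hi => Real.rpow_le_rpow (hγ j).le
        (hmono (Nat.lt_succ_iff.1 (Finset.mem_range.1 hi))) hl.le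
    simpa using this
  have h2 : γ j ^ l ≤ (∑' i, γ i ^ l) / ((j : ℝ) + 1) := by
    rw [le_div_iff₀ (by positivity), mul_comm]
    exact h1
  rw [← Real.div_rpow (tsum_nonneg hpos) (by positivity)]
  calc γ j = (γ j ^ l) ^ (1 / l) := by
        rw [← Real.rpow_mul (hγ j).le, mul_one_div, div_self hl.ne', Real.rpow_one]
    _ ≤ _ := Real.rpow_le_rpow (hpos j) h2 (by positivity)

theorem rSum_le_exp {α : ℝ} (hα : 1 / 2 < α) {γ : ℕ → ℝ} (hγ : ∀ j, 0 < γ j) (s : ℕ) {B : ℝ}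
    (hB : ∑ j ∈ Finset.range s, γ j ≤ B) :
    rSum α γ s ≤ Real.exp (2 * B * realZeta (2 * α)) := by
  have hz := realZeta_nonneg (x := 2 * α) (by linarith)
  calc rSum α γ s ≤ ∏ j ∈ Finset.range s, Real.exp (2 * γ j * realZeta (2 * α)) := by
        refine Finset.prod_le_prod (fun j _ => ?_) fun j _ => ?_
        · have := hγ j
          positivity
        · rw [add_comm]
          exact Real.add_one_le_exp _
    _ = Real.exp (2 * (∑ j ∈ Finset.range s, γ j) * realZeta (2 * α)) := by
        rw [← Real.exp_sum, Finset.mul_sum, Finset.sum_mul]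
    _ ≤ _ := by gcongr

theorem sum_rpow_weights_le {γ : ℕ → ℝ} (hγ : ∀ j, 0 < γ j) {C p lam : ℝ} (hC : 0 ≤ C)
    (hle : ∀ j : ℕ, γ j ≤ C / ((j : ℝ) + 1) ^ p) (hlam : 0 < lam) (hp : 1 < p * lam) (s : ℕ) :
    ∑ j ∈ Finset.range s, γ j ^ lam ≤ C ^ lam * realZeta (p * lam) := by
  have hz := hasSum_realZeta hp
  calc ∑ j ∈ Finset.range s, γ j ^ lam
      ≤ ∑ j ∈ Finset.range s, C ^ lam * (1 / ((j : ℝ) + 1) ^ (p * lam)) := by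
        refine Finset.sum_le_sum fun j _ => ?_
        rw [mul_one_div, Real.rpow_mul (by positivity), ← Real.div_rpow hC (by positivity)]
        exact Real.rpow_le_rpow (hγ j).le (hle j) hlam.le
    _ = C ^ lam * ∑ j ∈ Finset.range s, 1 / ((j : ℝ) + 1) ^ (p * lam) := by
        rw [Finset.mul_sum]
    _ ≤ _ := by
        gcongr
        rw [← hz.tsum_eq]
        exact hz.summable.sum_le_tsum _ fun j _ => by positivity

/-- Comparison with the integral of x^(-p) from d to d + t, whose upper endpoint term is dropped. -/
theorem sum_tail_rpow_le {d : ℕ} (hd : 0 < d) {p : ℝ} (hp : 1 < p) (t : ℕ) :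
    ∑ j ∈ Finset.range t, 1 / ((d : ℝ) + j + 1) ^ p ≤ 1 / (d : ℝ) ^ (p - 1) / (p - 1) := by
  have hd' : (0 : ℝ) < d := by exact_mod_cast hd
  have hanti : AntitoneOn (fun x : ℝ => x ^ (-p)) (Set.Icc (d : ℝ) (d + t)) := by
    intro x hx y hy hxy
    exact Real.rpow_le_rpow_of_nonpos (hd'.trans_le hx.1) hxy (by linarith)
  have h := hanti.sum_le_integral
  rw [integral_rpow (Or.inr ⟨by linarith, fun h0 => by
    rw [Set.uIcc_of_le (by simp)] at h0
    exact absurd h0.1 (not_le.2 hd')⟩)] at h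
  have e : ∀ j : ℕ, 1 / ((d : ℝ) + j + 1) ^ p = ((d : ℝ) + ((j + 1 : ℕ) : ℝ)) ^ (-p) := fun j => by
    rw [Real.rpow_neg (by positivity), one_div]
    push_cast
    rw [add_assoc]
  simp_rw [e]
  refine h.trans ?_
  have h1 : 0 ≤ ((d : ℝ) + t) ^ (-p + 1) := by positivity
  have h2 : 1 / (d : ℝ) ^ (p - 1) = (d : ℝ) ^ (-p + 1) := by
    rw [one_div, ← Real.rpow_neg hd'.le]
    congr 1
    ring
  rw [h2, ← neg_div_neg_eq]
  rw [show -(-p + 1) = p - 1 by ring]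
  have : 0 < p - 1 := by linarith
  gcongr
  linarith

/-- Convexity of exp between 0 and x. Applied with t = d^(-(p - 1)), it moves the decay in d out of
the exponent. -/
theorem exp_mul_sub_one_le {t : ℝ} (ht0 : 0 ≤ t) (ht1 : t ≤ 1) (x : ℝ) :
    Real.exp (t * x) - 1 ≤ t * (-1 + Real.exp x) := by
  have := convexOn_exp.2 (Set.mem_univ x) (Set.mem_univ 0) ht0 (sub_nonneg.2 ht1) (by ring)
  simp only [smul_eq_mul, mul_zero, add_zero, Real.exp_zero, mul_one] at this
  linarith

theorem le_ofReal_rpow_of_mul_rpow_add_one_le {E : ℝ≥0∞} (hE : E ≠ ∞) {n : ℕ} (hn : 0 < n)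
    {lam B : ℝ} (hlam : 0 < lam) (hB : 0 ≤ B) (h : (n : ℝ≥0∞) * E ^ lam + 1 ≤ ENNReal.ofReal B) :
    E ≤ ENNReal.ofReal ((1 / (n : ℝ) * (-1 + B)) ^ (1 / lam)) := by
  lift E to NNReal using hE
  have h' : (n : ℝ) * (E : ℝ) ^ lam + 1 ≤ B := by
    rw [← ENNReal.ofReal_coe_nnreal, ENNReal.ofReal_rpow_of_nonneg E.coe_nonneg hlam.le,
      ← ENNReal.ofReal_natCast, ← ENNReal.ofReal_mul (by positivity), ← ENNReal.ofReal_one,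
      ← ENNReal.ofReal_add (by positivity) zero_le_one, ENNReal.ofReal_le_ofReal_iff hB] at h
    exact h
  rw [← ENNReal.ofReal_coe_nnreal]
  refine ENNReal.ofReal_le_ofReal ?_
  have hn' : (0 : ℝ) < n := by exact_mod_cast hn
  calc (E : ℝ) = ((E : ℝ) ^ lam) ^ (1 / lam) := by
        rw [← Real.rpow_mul E.coe_nonneg, mul_one_div, div_self hlam.ne', Real.rpow_one]
    _ ≤ _ := by
        refine Real.rpow_le_rpow (by positivity) ?_ (by positivity)
        rw [one_div, inv_mul_eq_div, le_div_iff₀ hn']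
        linarith

theorem random_part_le {α : ℝ} (hα : 1 / 2 < α) {γ : ℕ → ℝ} (hγ : ∀ j, 0 < γ j) {C p : ℝ}
    (hC : 0 ≤ C) (hp : 1 < p) (hle : ∀ j : ℕ, γ j ≤ C / ((j : ℝ) + 1) ^ p) {N d : ℕ}
    (hd : 0 < d) (t : ℕ) :
    1 / N * rSum α γ d * (rSum α (fun j => γ (d + j)) t - 1) ≤
      Real.exp (2 * C * realZeta (2 * α) * realZeta p) / ((N : ℝ) * (d : ℝ) ^ (p - 1)) *
        (-1 + Real.exp (2 * C * realZeta (2 * α) / (p - 1))) := by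
  have hz := realZeta_nonneg (x := 2 * α) (by linarith)
  have hp1 : 0 < p - 1 := by linarith
  have hd1 : (1 : ℝ) ≤ d := by exact_mod_cast hd
  have hdp : 1 ≤ (d : ℝ) ^ (p - 1) := Real.one_le_rpow hd1 hp1.le
  have hγ' : ∀ j, 0 < γ (d + j) := fun j => hγ _
  have h1 : rSum α γ d ≤ Real.exp (2 * C * realZeta (2 * α) * realZeta p) := by
    have := sum_rpow_weights_le hγ hC hle one_pos (by simpa using hp) d
    simp only [Real.rpow_one, mul_one] at this
    refine (rSum_le_exp hα hγ d this).trans_eq ?_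
    congr 1
    ring
  have h2 : rSum α (fun j => γ (d + j)) t - 1 ≤
      1 / (d : ℝ) ^ (p - 1) * (-1 + Real.exp (2 * C * realZeta (2 * α) / (p - 1))) := by
    have hs : ∑ j ∈ Finset.range t, γ (d + j) ≤ C * (1 / (d : ℝ) ^ (p - 1) / (p - 1)) := by
      refine le_trans (Finset.sum_le_sum fun j _ => ?_)
        ((Finset.mul_sum _ _ C).symm.trans_le
          (mul_le_mul_of_nonneg_left (sum_tail_rpow_le hd hp t) hC))
      have := hle (d + j)
      push_cast at this
      rwa [mul_one_div]
    refine le_trans (sub_le_sub_right (rSum_le_exp hα hγ' t hs) 1) ?_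
    refine le_trans (le_of_eq ?_) (exp_mul_sub_one_le (t := 1 / (d : ℝ) ^ (p - 1))
      (by positivity) (div_le_one_of_le₀ hdp (by positivity)) _)
    congr 2
    ring
  have h3 : 0 ≤ rSum α (fun j => γ (d + j)) t - 1 := by
    linarith [one_le_rSum hα hγ' t]
  calc _ ≤ 1 / N * Real.exp (2 * C * realZeta (2 * α) * realZeta p) *
        (1 / (d : ℝ) ^ (p - 1) * (-1 + Real.exp (2 * C * realZeta (2 * α) / (p - 1)))) := by
        gcongr
    _ = _ := by ring

theorem lattice_part_le {α lam : ℝ} (hα : 1 / 2 < α) (hlam : 1 / (2 * α) < lam) (hlam1 : lam ≤ 1)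
    {γ : ℕ → ℝ} (hγ : ∀ j, 0 < γ j) {C p : ℝ} (hC : 0 ≤ C) (hp : 1 < p * lam)
    (hle : ∀ j : ℕ, γ j ≤ C / ((j : ℝ) + 1) ^ p) {N d : ℕ} (hN : 1 < N) {z : Fin d → ℕ}
    (hz : IsCBC α γ N d z) :
    sqError α γ (latticePoints N z) ≤ ENNReal.ofReal ((1 / (N.totient : ℝ) *
      (-1 + Real.exp (2 * C ^ lam * realZeta (2 * α * lam) * realZeta (p * lam)))) ^ (1 / lam)) := by
  have hlam0 : 0 < lam := lt_trans (by positivity) hlam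
  have hαl : 1 / 2 < α * lam := by
    rw [div_lt_iff₀ (by positivity)] at hlam
    linarith
  refine le_ofReal_rpow_of_mul_rpow_add_one_le (sqError_ne_top hα hγ _)
    (Nat.totient_pos.2 (by omega)) hlam0 (Real.exp_nonneg _)
    ((totient_mul_sqError_rpow_le hα hlam hlam1 hγ hN hz d le_rfl).trans
      (ENNReal.ofReal_le_ofReal ((rSum_le_exp hαl (fun j => Real.rpow_pos_of_pos (hγ j) _) d
        (sum_rpow_weights_le hγ hC hle hlam0 hp d)).trans_eq ?_)))
  rw [← mul_assoc 2 α lam]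
  congr 1
  ring

end Korobov

/-! ### Assembling the bound. -/

theorem theorem1 (γ : ℕ → ℝ) (hγpos : ∀ j, 0 < γ j) (hγmono : Antitone γ)
    (lamStar : ℝ) (hlamStar0 : 0 < lamStar) (hlamStar1 : lamStar < 1)
    (hγsum : Summable fun j => γ j ^ lamStar) :
    ∃ C : ℝ, 0 < C ∧
      ∀ (α : ℝ), 1 / 2 < α →
      ∀ (N s d : ℕ), 0 < N → 0 < d → d < s →
      ∀ (z : Fin d → ℕ), Korobov.IsCBC α γ N d z →
      ∀ (Ω : Type*) [MeasurableSpace Ω] (μ : Measure Ω) [IsProbabilityMeasure μ]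
        (X : Fin N → {j : Fin s // d ≤ (j : ℕ)} → Ω → ℝ),
        (∀ n j, Measurable (X n j)) →
        (∀ n j, pdf.IsUniform (X n j) (Set.Ico 0 1) μ volume) →
        iIndepFun (fun p : Fin N × {j : Fin s // d ≤ (j : ℕ)} => X p.1 p.2) μ →
        (Measurable fun ω =>
          Korobov.worstCaseError α γ (Korobov.concatPoints z fun n j => X n j ω) ^ 2) ∧
        ∀ (lam : ℝ), max lamStar (1 / (2 * α)) < lam → lam ≤ 1 →
          ∫⁻ ω, Korobov.worstCaseError α γ (Korobov.concatPoints z fun n j => X n j ω) ^ 2 ∂μ ≤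
            ENNReal.ofReal
              ((1 / (Nat.totient N : ℝ) *
                  (-1 + Real.exp (2 * C ^ lam * Korobov.realZeta (2 * α * lam) *
                    Korobov.realZeta (lam / lamStar)))) ^ (1 / lam) +
                Real.exp (2 * C * Korobov.realZeta (2 * α) * Korobov.realZeta (1 / lamStar)) /
                    ((N : ℝ) * (d : ℝ) ^ (1 / lamStar - 1)) *
                  (-1 + Real.exp (2 * C * Korobov.realZeta (2 * α) / (1 / lamStar - 1)))) := by
  have hApos : 0 < ∑' i, γ i ^ lamStar :=
    hγsum.tsum_pos (fun i => Real.rpow_nonneg (hγpos i).le _) 0 (Real.rpow_pos_of_pos (hγpos 0) _)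
  have hC : 0 < (∑' i, γ i ^ lamStar) ^ (1 / lamStar) := Real.rpow_pos_of_pos hApos _
  have hle := Korobov.le_div_rpow_of_antitone hγpos hγmono hlamStar0 hγsum
  refine ⟨_, hC, ?_⟩
  -- From here on only positivity of C and the decay of the weights matter.
  generalize (∑' i, γ i ^ lamStar) ^ (1 / lamStar) = C at hC hle
  intro α hα N s d hN hd hds z hz Ω _ μ _ X hm hu hi
  simp_rw [Korobov.worstCaseError_sq hα hγpos hN]
  refine ⟨Korobov.measurable_sqError_concatPoints hm z α γ, fun lam hlam hlam1 => ?_⟩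
  obtain ⟨t, rfl⟩ := Nat.exists_eq_add_of_le hds.le
  -- As d > 0, the first component lies in {1, …, N - 1}, which must be nonempty.
  have hN1 : 1 < N := by
    have := Finset.mem_Icc.1 (hz.mem ⟨0, hd⟩)
    omega
  have hlam' : lamStar < lam := (le_max_left _ _).trans_lt hlam
  have hp : 1 < 1 / lamStar := by rwa [one_lt_div hlamStar0]
  have hpl : 1 / lamStar * lam = lam / lamStar := by ring
  have hpl1 : 1 < 1 / lamStar * lam := by rwa [hpl, one_lt_div hlamStar0]
  rw [Korobov.lintegral_sqError_concatPoints hN hm hu hi z hα hγpos]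
  have h1 := Korobov.lattice_part_le hα ((le_max_right _ _).trans_lt hlam) hlam1 hγpos hC.le hpl1
    hle hN1 hz
  rw [hpl] at h1
  have h2 := Korobov.random_part_le (N := N) hα hγpos hC.le hp hle hd t
  have h3 : 0 ≤ 1 / (N : ℝ) * Korobov.rSum α γ d *
      (Korobov.rSum α (fun j => γ (d + j)) t - 1) := by
    have := Korobov.one_le_rSum hα hγpos d
    have := sub_nonneg.2 (Korobov.one_le_rSum hα (fun j => hγpos (d + j)) t)
    positivity
  refine (add_le_add h1 (ENNReal.ofReal_le_ofReal h2)).trans_eq ?_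
  rw [ENNReal.ofReal_add _ (h3.trans h2)]
  have hζ : 0 ≤ Korobov.realZeta (2 * α * lam) := by
    refine Korobov.realZeta_nonneg ?_
    have := (le_max_right _ _).trans_lt hlam
    rwa [div_lt_iff₀ (by positivity), mul_comm] at this
  have hζ' : 0 ≤ Korobov.realZeta (lam / lamStar) := Korobov.realZeta_nonneg (hpl ▸ hpl1)
  refine Real.rpow_nonneg (mul_nonneg (by positivity) ?_) _
  linarith [Real.one_le_exp (x := 2 * C ^ lam * Korobov.realZeta (2 * α * lam) *
    Korobov.realZeta (lam / lamStar)) (by positivity)]
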